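/- **Setting.** Let $Z$ be a set, $C$ a finite set with at least two elements (the controller configurations) and $K\ge 1$, $n\ge 0$ integers. A *perfect-perception model* $\mathcal M$ consists of a finite set $S\subseteq Z\times[K]\times\{1,2,3\}\times C$ of states $(z,k,t,c)$, an initial state $s_0\in S$, a labelling $L:S\to 2^{AP}$, a family $R$ of (non-negative) state/transition reward structures, and transition probabilities $P(s,\cdot)$ on $S$ for the states $s$ with $t\ne 3$, such that transitions of positive probability from a state with $t=1$ keep $k$ and $c$ and lead to $t'<3$, and those from a state with $t=2$ keep $z$ and $c$ and lead to $t'=3$; moreover $(z,k,3,c)\in S$ implies $(z,k,1,c')\in S$ for all $c'\in C$. A (probabilistic) *perfect-perception controller* is a family $x_{zkcc'}\ge 0$, indexed by the $(z,k,3,c)\in S$ and $c'\in C$, with $\sum_{c'}x_{zkcc'}=1$; it turns $\mathcal M$ into a DTMC $\mathcal M_x$ by $P((z,k,3,c),(z,k,1,c'))=x_{zkcc'}$. Let $f:\mathbb R^d\to[K]$ be a classifier with verification functions $\mathit{verif}_1,\dots,\mathit{verif}_n:\mathbb R^d\to\mathbb B$, and let $X\subset\mathbb R^d$ be a finite test set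 with true labels $f^*$ in which every class occurs. Put $$p_{k\hat kv}=\frac{\#\{x\in X: f^*(x)=k,\ f(x)=\hat k,\ \mathit{verif}(x)=v\}}{\#\{x\in X: f^*(x)=k\}}\qquad (k,\hat k\in[K],\ v\in\mathbb B^n).$$ A (probabilistic) *DNN-perception controller* is a family $\hat x_{z\hat kvcc'}\ge0$, indexed by the $(z,\hat k,v,c)$ such that $(z,k,3,c)\in S$ for some $k$, and $c'\in C$, with $\sum_{c'}\hat x_{z\hat kvcc'}=1$. Its DTMC $\hat{\mathcal M}_{\hat x}$ has the states $(z,k,\hat k,v,t,c)$ with $(z,k,t,c)\in S$, the initial state $(z_0,k_0,k_0,\mathsf{true},\dots,\mathsf{true},t_0,c_0)$ where $s_0=(z_0,k_0,t_0,c_0)$, and labels and rewards inherited from $(z,k,t,c)$. Its transitions with $t=1$ are those of $\mathcal M$ with $(\hat k,v)$ unchanged; those with $t=2$ have probability $P((z,k,2,c),(z',k',t',c'))\,p_{k'\hat k'v'}$; and $(z,k,\hat k,v,3,c)\to(z,k,\hat k,v,1,c')$ has probability $\hat x_{z\hat kvcc'}$. A *combination* consists of finitely many (possibly no) constraints, each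 a PCTL state formula over $AP$ or a bounded reward formula $\mathcal R_{\sim r}[\mathrm C^{\le m}]$, $\mathcal R_{\sim r}[\mathrm F\,\Phi]$ over one of the reward structures, and at least one objective, which asks to maximise or minimise a quantity $\mathcal P_{=?}[\Psi]$, $\mathcal R_{=?}[\mathrm C^{\le m}]$ or $\mathcal R_{=?}[\mathrm F\,\Phi]$. Constraints and quantities are evaluated in the initial state. Call the combination *separating* if there is a perfect-perception controller $x$ such that $\mathcal M_x$ satisfies the constraints, and no DNN-perception controller $\hat x$ is such that $\hat{\mathcal M}_{\hat x}$ satisfies the constraints and yields the same values as $\mathcal M_x$ for the quantities of all objectives. **Statement.** Assume that distinct states of $S$ have distinct label sets, and that perception is imperfect in the following sense: there are $z\in Z$, $c\in C$, classes $k_1\neq k_2$ and an outcome $(\hat k_0,v_0)$ with $p_{k_1\hat k_0v_0}>0$ and $p_{k_2\hat k_0v_0}>0$ such that $(z,k_1,3,c)$ and $(z,k_2,3,c)$ belong to $S$ and can each be entered from $s_0$ in one or more steps under some perfect-perception controller. Then: 1. There are infinitely many separating combinations; moreover, there are infinitely many with pairwise different sets of perfect-perception controllers that satisfy the constraints. 2.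 Let $x$ be a perfect-perception controller, let $c_1\ne c_2$ in $C$, and let $\alpha_1,\alpha_2$ be real numbers with $$x_{zk_icc_i}=\alpha_i\,p_{k_i\hat k_0v_0}+\sum_{(\hat k,v)\neq(\hat k_0,v_0)}p_{k_i\hat kv}\qquad(i=1,2).$$ If $\alpha_1+\alpha_2>1$, then no DNN-perception controller $\hat x$ solves the equivalence equation $$x_{z'kc'c''}=\sum_{\hat k\in[K]}\sum_{v\in\mathbb B^n}p_{k\hat kv}\,\hat x_{z'\hat kvc'c''}\qquad\text{for all }(z',k,3,c')\in S,\ c''\in C.$$ There are infinitely many perfect-perception controllers $x$ of this kind, even with $\alpha_1,\alpha_2\in[0,1]$. -/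

import Mathlib

open scoped ENNReal NNReal

universe u

noncomputable section

namespace DeepDECS

/-! ### Reward-augmented discrete-time Markov chains and their path measure -/

/-- A reward structure: state rewards `ρ` and transition rewards `ι`. -/
structure RewardStructure (S : Type*) where
  ρ : S → ℝ≥0
  ι : S → S → ℝ≥0

/-- A reward-augmented DTMC with finite state set `S`, atomic propositions `AP`, and reward
structures that are indexed by the names `RN`. -/
structure DTMC (S : Type*) [Fintype S] (AP RN : Type*) where
  s₀ : S
  P : S → S → ℝ
  P_nonneg : ∀ s s', 0 ≤ P s s'
  P_sum : ∀ s, ∑ s', P s s' = 1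
  L : S → Set AP
  R : RN → RewardStructure S

namespace DTMC

variable {S : Type*} [Fintype S] {AP RN : Type*} (M : DTMC S AP RN)

/-- The distribution of the successor of the state `s`. -/
def step (s : S) : PMF S :=
  PMF.ofFintype (fun s' => ENNReal.ofReal (M.P s s')) (by
    rw [← ENNReal.ofReal_sum_of_nonneg (fun s' _ => M.P_nonneg s s'), M.P_sum,
      ENNReal.ofReal_one])

/-- The law of the state at time `n + 1` given the states up to time `n`. The finite set `S`
carries the discrete σ-algebra. -/
def stepKernel (n : ℕ) :
    letI : MeasurableSpace S := ⊤
    ProbabilityTheory.Kernel ((i : Finset.Iic n) → (fun _ : ℕ => S) i) S :=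
  letI : MeasurableSpace S := ⊤
  ProbabilityTheory.Kernel.ofFunOfCountable
    (fun h => (M.step (h ⟨n, Finset.mem_Iic.2 le_rfl⟩)).toMeasure)

theorem stepKernel_isMarkov (n : ℕ) :
    letI : MeasurableSpace S := ⊤
    ProbabilityTheory.IsMarkovKernel (M.stepKernel n) := by
  let _ : MeasurableSpace S := ⊤
  exact ⟨fun h => inferInstanceAs (MeasureTheory.IsProbabilityMeasure
    (M.step (h ⟨n, Finset.mem_Iic.2 le_rfl⟩)).toMeasure)⟩

/-- The law of the infinite path of the chain that starts in the state `s`. -/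
def pathMeasure (s : S) :
    letI : MeasurableSpace S := ⊤
    MeasureTheory.Measure (ℕ → S) :=
  letI : MeasurableSpace S := ⊤
  haveI := M.stepKernel_isMarkov
  ProbabilityTheory.Kernel.traj (X := fun _ => S) M.stepKernel 0 (fun _ => s)

/-- The probability that the path started in `s` belongs to `A`. -/
def pathProb (s : S) (A : Set (ℕ → S)) : ℝ≥0∞ :=
  letI : MeasurableSpace S := ⊤
  M.pathMeasure s A

/-- The expectation of `g` over the path started in `s`. -/
def pathExp (s : S) (g : (ℕ → S) → ℝ≥0∞) : ℝ≥0∞ :=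
  letI : MeasurableSpace S := ⊤
  ∫⁻ π, g π ∂(M.pathMeasure s)

end DTMC

/-! ### PCTL with rewards -/

/-- The relational operators `≥`, `>`, `<`, `≤`. -/
inductive Cmp
  | ge | gt | lt | le

/-- The meaning of `a ∼ b`. -/
def Cmp.holds : Cmp → ℝ≥0∞ → ℝ≥0∞ → Prop
  | .ge, a, b => b ≤ a
  | .gt, a, b => b < a
  | .lt, a, b => a < b
  | .le, a, b => a ≤ b

mutual

/-- State formulae. -/
inductive StateFormula (AP : Type u)
  | tt : StateFormula AP
  | atom (a : AP) : StateFormula AP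
  | and (Φ₁ Φ₂ : StateFormula AP) : StateFormula AP
  | not (Φ : StateFormula AP) : StateFormula AP
  | prob (r : Cmp) (p : unitInterval) (Ψ : PathFormula AP) : StateFormula AP

/-- Path formulae: next, until, time-bounded until. -/
inductive PathFormula (AP : Type u)
  | next (Φ : StateFormula AP) : PathFormula AP
  | untl (Φ₁ Φ₂ : StateFormula AP) : PathFormula AP
  | boundedUntl (Φ₁ : StateFormula AP) (k : ℕ+) (Φ₂ : StateFormula AP) : PathFormula AP

end

/-- The reward properties `C^{≤ k}` and `F Φ`. -/
inductive RewardProperty (AP : Type*)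
  | cumul (k : ℕ+) : RewardProperty AP
  | reach (Φ : StateFormula AP) : RewardProperty AP

/-- A reward formula `R_{∼ r}[⋯]` over the reward structure with the given name. -/
structure RewardFormula (AP RN : Type*) where
  name : RN
  cmp : Cmp
  bound : ℝ≥0
  property : RewardProperty AP

section Semantics

variable {S : Type*} [Fintype S] {AP RN : Type*} (M : DTMC S AP RN)

mutual

/-- `s ⊨ Φ`. -/
def StateFormula.Sat : StateFormula AP → S → Prop
  | .tt, _ => True
  | .atom a, s => a ∈ M.L s
  | .and Φ₁ Φ₂, s => StateFormula.Sat Φ₁ s ∧ StateFormula.Sat Φ₂ s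
  | .not Φ, s => ¬ StateFormula.Sat Φ s
  | .prob r p Ψ, s =>
      r.holds (M.pathProb s {π | PathFormula.Sat Ψ π}) (ENNReal.ofReal (p : ℝ))
termination_by structural Φ => Φ

/-- The infinite path `π` satisfies `Ψ`. In `Φ₁ U^{≤ k} Φ₂`, `Φ₁` holds in the first `i < k` states
of the path and `Φ₂` in the next one. -/
def PathFormula.Sat : PathFormula AP → (ℕ → S) → Prop
  | .next Φ, π => StateFormula.Sat Φ (π 1)
  | .untl Φ₁ Φ₂, π => ∃ i, (∀ j < i, StateFormula.Sat Φ₁ (π j)) ∧ StateFormula.Sat Φ₂ (π i)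
  | .boundedUntl Φ₁ k Φ₂, π =>
      ∃ i < (k : ℕ), (∀ j < i, StateFormula.Sat Φ₁ (π j)) ∧ StateFormula.Sat Φ₂ (π i)
termination_by structural Ψ => Ψ

end

/-- The reward accumulated in the first `m` steps of the path `π`. -/
def RewardStructure.accumulated (w : RewardStructure S) (m : ℕ) (π : ℕ → S) : ℝ≥0∞ :=
  ∑ i ∈ Finset.range m, ((w.ρ (π i) + w.ι (π i) (π (i + 1)) : ℝ≥0) : ℝ≥0∞)

open Classical in
/-- The reward on the path `π` that the property refers to. The reward accumulated before reaching
`Φ` is infinite if `Φ` is never reached. -/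
def RewardProperty.pathReward (w : RewardStructure S) :
    RewardProperty AP → (ℕ → S) → ℝ≥0∞
  | .cumul k, π => w.accumulated k π
  | .reach Φ, π =>
      if h : ∃ i, StateFormula.Sat M Φ (π i) then w.accumulated (Nat.find h) π else ∞

/-- The value of `P =? [Ψ]` in the initial state. -/
def PathFormula.pmc (Ψ : PathFormula AP) : ℝ≥0∞ :=
  M.pathProb M.s₀ {π | PathFormula.Sat M Ψ π}

/-- The value of `R =? [⋯]` in the initial state. -/
def RewardProperty.pmc (name : RN) (F : RewardProperty AP) : ℝ≥0∞ :=
  M.pathExp M.s₀ (F.pathReward M (M.R name))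

end Semantics

/-! ### Constraints and optimisation objectives -/

/-- A constraint is a state formula or a reward formula. -/
inductive Constraint (AP RN : Type*)
  | state (Φ : StateFormula AP) : Constraint AP RN
  | reward (Φ : RewardFormula AP RN) : Constraint AP RN

/-- A quantitative system property `P =? [Ψ]` or `R =? [⋯]`. -/
inductive SystemProperty (AP RN : Type*)
  | prob (Ψ : PathFormula AP) : SystemProperty AP RN
  | reward (name : RN) (F : RewardProperty AP) : SystemProperty AP RN

/-- The direction of an optimisation. -/
inductive Direction
  | maximise | minimise

/-- An optimisation objective. -/
structure Objective (AP RN : Type*) where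
  direction : Direction
  property : SystemProperty AP RN

/-- A combination of `n₁ ≥ 0` constraints and `n₂ ≥ 1` optimisation objectives. -/
structure Combination (AP RN : Type*) where
  constraints : List (Constraint AP RN)
  objectives : List (Objective AP RN)
  objectives_ne : objectives ≠ []

section Requirements

variable {S : Type*} [Fintype S] {AP RN : Type*} (M : DTMC S AP RN)

/-- The chain satisfies the constraint (in its initial state). -/
def Constraint.Sat : Constraint AP RN → Prop
  | .state Φ => StateFormula.Sat M Φ M.s₀
  | .reward Φ => Φ.cmp.holds (Φ.property.pmc M Φ.name) (Φ.bound : ℝ≥0∞)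

/-- The value of a system property. -/
def SystemProperty.value : SystemProperty AP RN → ℝ≥0∞
  | .prob Ψ => Ψ.pmc M
  | .reward name F => F.pmc M name

/-- The chain satisfies all constraints of the combination. -/
def Combination.Sat (Q : Combination AP RN) : Prop :=
  ∀ γ ∈ Q.constraints, γ.Sat M

end Requirements

/-- Two chains yield the same values for the properties from the objectives. -/
def Combination.SameValues {S T AP RN : Type*} [Fintype S] [Fintype T] (Q : Combination AP RN)
    (M : DTMC S AP RN) (N : DTMC T AP RN) : Prop :=
  ∀ o ∈ Q.objectives, o.property.value M = o.property.value N

/-! ### DNN perception -/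

/-- A classifier `f` of inputs from `ℝ^d` into `K` classes, `n` verification techniques for it, and
a labelled finite test dataset `X` in which every class occurs. -/
structure Perception (d K n : ℕ) where
  f : EuclideanSpace ℝ (Fin d) → Fin K
  verif : Fin n → EuclideanSpace ℝ (Fin d) → Bool
  X : Finset (EuclideanSpace ℝ (Fin d))
  fstar : EuclideanSpace ℝ (Fin d) → Fin K
  class_occurs : ∀ k, ∃ x ∈ X, fstar x = k

namespace Perception

variable {d K n : ℕ} (D : Perception d K n)

open Classical in
/-- The confusion matrix `C_v`. -/
def confusion (v : Fin n → Bool) (k k' : Fin K) : ℕ :=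
  (D.X.filter (fun x => (fun i => D.verif i x) = v ∧ D.fstar x = k ∧ D.f x = k')).card

/-- The probability `p_{k k' v}` that an input of class `k` is classified as `k'` with
verification result `v`. -/
def p (k k' : Fin K) (v : Fin n → Bool) : ℝ :=
  (D.confusion v k k' : ℝ) / ∑ v' : Fin n → Bool, ∑ k'' : Fin K, (D.confusion v' k k'' : ℝ)

theorem p_nonneg (k k' : Fin K) (v : Fin n → Bool) : 0 ≤ D.p k k' v := by
  unfold p; positivity

theorem p_sum (k : Fin K) : ∑ k', ∑ v, D.p k k' v = 1 := by
  classical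
  have hpos : 0 < ∑ v' : Fin n → Bool, ∑ k'' : Fin K, (D.confusion v' k k'' : ℝ) := by
    obtain ⟨x, hx, hk⟩ := D.class_occurs k
    have h1 : 0 < D.confusion (fun i => D.verif i x) k (D.f x) :=
      Finset.card_pos.2 ⟨x, by simp [hx, hk]⟩
    refine Finset.sum_pos' (fun v _ => Finset.sum_nonneg fun _ _ => Nat.cast_nonneg _)
      ⟨fun i => D.verif i x, Finset.mem_univ _, ?_⟩
    exact Finset.sum_pos' (fun _ _ => Nat.cast_nonneg _)
      ⟨D.f x, Finset.mem_univ _, by exact_mod_cast h1⟩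
  rw [Finset.sum_comm]
  simp only [p, ← Finset.sum_div]
  exact div_self hpos.ne'

end Perception

/-! ### The perfect-perception model -/

/-- The turn flag; the values `system`, `monitor`, `control` stand for `t = 1, 2, 3`. -/
inductive Turn
  | system | monitor | control

/-- A tuple `(z, k, t, c)`. -/
@[ext]
structure Tuple (Z C : Type*) (K : ℕ) where
  z : Z
  k : Fin K
  t : Turn
  c : C

/-- A perfect-perception parametric DTMC. The transition probabilities out of the states with
`t = 3` are the controller parameters, so `P` matters in the rows of the other states only. -/
structure PerfectModel (Z C : Type*) (K : ℕ) (AP RN : Type*) where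
  S : Finset (Tuple Z C K)
  s₀ : S
  P : S → S → ℝ
  P_nonneg : ∀ s s' : S, s.1.t ≠ .control → 0 ≤ P s s'
  P_sum : ∀ s : S, s.1.t ≠ .control → ∑ s', P s s' = 1
  system_step : ∀ s s' : S, s.1.t = .system → 0 < P s s' →
    s'.1.k = s.1.k ∧ s'.1.c = s.1.c ∧ s'.1.t ≠ .control
  monitor_step : ∀ s s' : S, s.1.t = .monitor → 0 < P s s' →
    s'.1.z = s.1.z ∧ s'.1.c = s.1.c ∧ s'.1.t = .control
  control_mem : ∀ z k c, (⟨z, k, .control, c⟩ : Tuple Z C K) ∈ S →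
    ∀ c', (⟨z, k, .system, c'⟩ : Tuple Z C K) ∈ S
  L : S → Set AP
  R : RN → RewardStructure S

namespace PerfectModel

variable {Z C : Type*} {K : ℕ} {AP RN : Type*} (M : PerfectModel Z C K AP RN)

theorem mem_control {s : M.S} (h : s.1.t = .control) :
    (⟨s.1.z, s.1.k, .control, s.1.c⟩ : Tuple Z C K) ∈ M.S := by
  have h2 : (⟨s.1.z, s.1.k, .control, s.1.c⟩ : Tuple Z C K) = s.1 := Tuple.ext rfl rfl h.symm rfl
  rw [h2]; exact s.2

/-- `s'` can follow `s` under some controller. -/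
def CanStep (s s' : M.S) : Prop :=
  (s.1.t = .control ∧ s'.1.z = s.1.z ∧ s'.1.k = s.1.k ∧ s'.1.t = .system) ∨
    (s.1.t ≠ .control ∧ 0 < M.P s s')

/-- `s` can be entered, after at least one step from the initial state, under some controller. -/
def CanEnter (s : M.S) : Prop :=
  Relation.TransGen M.CanStep M.s₀ s

variable [Fintype C]

/-- A probabilistic perfect-perception controller: parameters `x_{z k c c'}` for all `z, k, c` with
`(z, k, 3, c) ∈ S` and all `c'`. -/
structure Controller where
  x : (z : Z) → (k : Fin K) → (c : C) → (⟨z, k, .control, c⟩ : Tuple Z C K) ∈ M.S → C → ℝ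
  nonneg : ∀ z k c h c', 0 ≤ x z k c h c'
  sum_eq_one : ∀ z k c h, ∑ c', x z k c h c' = 1

theorem sum_control (s : M.S) (hs : (⟨s.1.z, s.1.k, .control, s.1.c⟩ : Tuple Z C K) ∈ M.S)
    (w : C → ℝ) (q : M.S → Prop) [DecidablePred q]
    (hq : ∀ s', q s' ↔ s'.1.z = s.1.z ∧ s'.1.k = s.1.k ∧ s'.1.t = .system) :
    ∑ s' : M.S, (if q s' then w s'.1.c else 0) = ∑ c', w c' := by
  symm
  refine Finset.sum_of_injOn
    (fun c' => (⟨⟨s.1.z, s.1.k, .system, c'⟩, M.control_mem _ _ _ hs c'⟩ : M.S)) ?_ ?_ ?_ ?_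
  · intro a _ b _ hab
    simpa using hab
  · intro a _; simp
  · intro s' _ hs'
    rw [if_neg]
    intro h
    obtain ⟨hz, hk, ht⟩ := (hq s').1 h
    apply hs'
    refine ⟨s'.1.c, by simp, ?_⟩
    apply Subtype.ext
    exact Tuple.ext hz.symm hk.symm ht.symm rfl
  · intro c' _
    symm
    exact if_pos ((hq ⟨⟨s.1.z, s.1.k, .system, c'⟩, M.control_mem _ _ _ hs c'⟩).2 ⟨rfl, rfl, rfl⟩)

open Classical in
/-- The transition probabilities under the controller `x`. -/
def trans (x : M.Controller) (s s' : M.S) : ℝ :=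
  if h : s.1.t = .control then
    if s'.1.z = s.1.z ∧ s'.1.k = s.1.k ∧ s'.1.t = .system then
      x.x s.1.z s.1.k s.1.c (M.mem_control h) s'.1.c
    else 0
  else M.P s s'

/-- The instance of the perfect-perception model for the controller `x`. -/
def inst (x : M.Controller) : DTMC M.S AP RN where
  s₀ := M.s₀
  P := M.trans x
  P_nonneg s s' := by
    unfold trans
    split_ifs with h1 h2
    · exact x.nonneg _ _ _ _ _
    · exact le_rfl
    · exact M.P_nonneg s s' h1
  P_sum s := by
    classical
    unfold trans
    by_cases h : s.1.t = .control
    · simp only [h, dite_true]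
      rw [← x.sum_eq_one s.1.z s.1.k s.1.c (M.mem_control h)]
      exact M.sum_control s (M.mem_control h) _ _ (fun _ => Iff.rfl)
    · simp only [h, dite_false]
      exact M.P_sum s h
  L := M.L
  R := M.R

/-! ### The DNN-perception model -/

/-- A probabilistic DNN-perception controller: parameters `x_{z k̂ v c c'}` for all `z, k̂, v, c`
with `(z, k, k̂, v, 3, c) ∈ Ŝ` (that is, `(z, k, 3, c) ∈ S`) for some `k`, and all `c'`. -/
structure DNNController (n : ℕ) where
  x : (z : Z) → (khat : Fin K) → (v : Fin n → Bool) → (c : C) →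
    (∃ k, (⟨z, k, .control, c⟩ : Tuple Z C K) ∈ M.S) → C → ℝ
  nonneg : ∀ z khat v c h c', 0 ≤ x z khat v c h c'
  sum_eq_one : ∀ z khat v c h, ∑ c', x z khat v c h c' = 1

/-- The states `(z, k, k̂, v, t, c)` with `(z, k, t, c) ∈ S`, written as
`((z, k, t, c), k̂, v)`. -/
abbrev DNNState (n : ℕ) : Type _ := M.S × Fin K × (Fin n → Bool)

variable {d n : ℕ} (D : Perception d K n)

open Classical in
/-- The transition probabilities of the DNN-perception model under the controller `x`. -/
def dnnTrans (x : M.DNNController n) (a a' : M.DNNState n) : ℝ :=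
  if h : a.1.1.t = .control then
    if (a'.1.1.z = a.1.1.z ∧ a'.1.1.k = a.1.1.k ∧ a'.1.1.t = .system) ∧ a'.2 = a.2 then
      x.x a.1.1.z a.2.1 a.2.2 a.1.1.c ⟨a.1.1.k, M.mem_control h⟩ a'.1.1.c
    else 0
  else if a.1.1.t = .monitor then
    M.P a.1 a'.1 * D.p a'.1.1.k a'.2.1 a'.2.2
  else if a'.2 = a.2 then M.P a.1 a'.1 else 0

/-- The instance of the DNN-perception model for the controller `x`. -/
def dnnInst (x : M.DNNController n) : DTMC (M.DNNState n) AP RN where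
  s₀ := (M.s₀, M.s₀.1.k, fun _ => true)
  P := M.dnnTrans D x
  P_nonneg a a' := by
    unfold dnnTrans
    split_ifs with h1 h2 h3 h4
    · exact x.nonneg _ _ _ _ _ _
    · exact le_rfl
    · exact mul_nonneg (M.P_nonneg _ _ h1) (D.p_nonneg _ _ _)
    · exact M.P_nonneg _ _ h1
    · exact le_rfl
  P_sum a := by
    classical
    unfold dnnTrans
    rw [Fintype.sum_prod_type]
    by_cases h : a.1.1.t = .control
    · simp only [h, dite_true, ite_and]
      rw [← x.sum_eq_one a.1.1.z a.2.1 a.2.2 a.1.1.c ⟨a.1.1.k, M.mem_control h⟩,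
        ← M.sum_control a.1 (M.mem_control h) _ _ (fun _ => Iff.rfl)]
      refine Finset.sum_congr rfl fun s' _ => ?_
      split_ifs <;> simp_all
    · by_cases h2 : a.1.1.t = .monitor
      · rw [← M.P_sum a.1 h]
        refine Finset.sum_congr rfl fun s' _ => ?_
        simp only [h2, reduceCtorEq, dite_false, if_true]
        rw [← Finset.mul_sum, Fintype.sum_prod_type, D.p_sum, mul_one]
      · simp only [h, h2, dite_false, if_false]
        simpa using M.P_sum a.1 h
  L a := M.L a.1
  R r := ⟨fun a => (M.R r).ρ a.1, fun a a' => (M.R r).ι a.1 a'.1⟩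

/-- The combination can be met with perfect perception but not with DNN perception: some
perfect-perception controller satisfies the constraints, and no DNN-perception controller
satisfies them and yields the same values for the objectives. -/
def Separates (Q : Combination AP RN) : Prop :=
  ∃ x : M.Controller, Q.Sat (M.inst x) ∧
    ¬ ∃ y : M.DNNController n, Q.Sat (M.dnnInst D y) ∧ Q.SameValues (M.dnnInst D y) (M.inst x)

/-- The equivalence equation between perfect-perception and DNN-perception parameters. -/
def EquivalenceEq (x : M.Controller) (y : M.DNNController n) : Prop :=
  ∀ z k c (h : (⟨z, k, .control, c⟩ : Tuple Z C K) ∈ M.S) (c' : C),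
    x.x z k c h c' = ∑ khat, ∑ v, D.p k khat v * y.x z khat v c ⟨k, h⟩ c'

open Classical in
/-- `x_{z k c c'} = α p_{k k̂ v} + ∑ p_{k k̂' v'}`, where the sum runs over all
`(k̂', v') ≠ (k̂, v)`. -/
def HasAlpha (x : M.Controller) (z : Z) (k : Fin K) (c : C)
    (h : (⟨z, k, .control, c⟩ : Tuple Z C K) ∈ M.S) (khat : Fin K) (v : Fin n → Bool) (c' : C)
    (α : ℝ) : Prop :=
  x.x z k c h c' = α * D.p k khat v +
    ∑ o ∈ (Finset.univ : Finset (Fin K × (Fin n → Bool))).erase (khat, v), D.p k o.1 o.2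

end PerfectModel

end DeepDECS

end

-- A DNN-perception controller sees the outcome `(khat, v)` but not the true class. The classes `k₁`
-- and `k₂` can both produce this outcome, so for given `z` and `c` they share one row of
-- parameters, which sums to `1`. Two demands on this row, one on `c₁` coming from `k₁` and one on
-- `c₂` coming from `k₂`, are incompatible once their lower bounds add up to more than `1`; a
-- perfect-perception controller meets them in separate rows.
--
-- For separating combinations the demands must be written in PCTL. Distinct label sets give each
-- state a characteristic formula, and iterated `P_{>0}[X ⋯]` expresses entry after a fixed number
-- of steps. Hence a formula can say that the control state is entered and that `c'` has probability
-- at least `p` at every such entry. In the DNN model this covers every outcome of positive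
-- probability (`exists_enters_and_chooses`). Thresholds `q` in `(1/2, 1)` yield the infinite family
-- (`infinite_image_separates`).
--
-- For the equivalence equation, bounding all other parameters by `1` turns the coefficient `α` into
-- a lower bound for the shared parameter (`EquivalenceEq.alpha_le`).

noncomputable section

namespace DeepDECS

/-! ### The next operator -/

namespace DTMC

variable {S : Type*} [Fintype S] {AP RN : Type*} (N : DTMC S AP RN)

open Classical in
/-- The probability that the first transition leads into `A`. -/
theorem pathProb_next (s : S) (A : Set S) :
    N.pathProb s {π | π 1 ∈ A} = ∑ s', if s' ∈ A then ENNReal.ofReal (N.P s s') else 0 := by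
  let _ : MeasurableSpace S := ⊤
  have : MeasurableSingletonClass S := ⟨fun _ => trivial⟩
  have := N.stepKernel_isMarkov
  -- The time-one marginal of the trajectory started at time `0` is `stepKernel 0`.
  have hmap := congrArg (fun κ => κ (fun _ => s) A)
    (ProbabilityTheory.Kernel.map_traj_succ_self (X := fun _ => S) (κ := N.stepKernel) (a := 0))
  have hmeas : Measurable (fun π : ℕ → S => π (0 + 1)) := measurable_pi_apply 1
  simp only [ProbabilityTheory.Kernel.map_apply _ hmeas] at hmap
  have hA : MeasurableSet A := trivial
  rw [MeasureTheory.Measure.map_apply hmeas hA] at hmap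
  refine hmap.trans ?_
  refine ((N.step s).toMeasure_apply_fintype A).trans (Finset.sum_congr rfl fun s' _ => ?_)
  simp [Set.indicator_apply, step]

/-- `s'` is reached from `s` in exactly `m` steps with positive probability. -/
def ReachesIn : ℕ → S → S → Prop
  | 0, s, s' => s = s'
  | m + 1, s, s' => ∃ u, ReachesIn m s u ∧ 0 < N.P u s'

end DTMC

-- Formulae for entering a state and for identifying it

namespace StateFormula

variable {S : Type*} [Fintype S] {AP RN : Type*} (N : DTMC S AP RN)

/-- Some transition of positive probability leads to a state that satisfies `Φ`. -/
def possiblyNext (Φ : StateFormula AP) : StateFormula AP :=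
  .prob .gt 0 (.next Φ)

/-- Some state that is reached in `m` steps satisfies `Φ`, and all such states satisfy `Ψ`. -/
def entersWith (m : ℕ) (Φ Ψ : StateFormula AP) : StateFormula AP :=
  .and (possiblyNext^[m] Φ) (.not (possiblyNext^[m] (.and Φ (.not Ψ))))

theorem sat_possiblyNext (Φ : StateFormula AP) (s : S) :
    Sat N (possiblyNext Φ) s ↔ ∃ s', 0 < N.P s s' ∧ Sat N Φ s' := by
  classical
  have h := N.pathProb_next s {s' | Sat N Φ s'}
  simp only [Set.mem_ofPred_eq] at h
  simp only [possiblyNext, StateFormula.Sat, PathFormula.Sat, Cmp.holds, h]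
  simp [pos_iff_ne_zero, Finset.sum_eq_zero_iff, and_comm]

theorem sat_iterate_possiblyNext (m : ℕ) (Φ : StateFormula AP) (s : S) :
    Sat N (possiblyNext^[m] Φ) s ↔ ∃ s', N.ReachesIn m s s' ∧ Sat N Φ s' := by
  induction m generalizing Φ with
  | zero => simp [DTMC.ReachesIn]
  | succ m ih =>
    -- The additional operator is the innermost one, next to `Φ`, which matches the last step in
    -- `ReachesIn`.
    simp only [Function.iterate_succ_apply, ih, sat_possiblyNext, DTMC.ReachesIn]
    constructor
    · rintro ⟨u, hu, s', hs', h⟩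
      exact ⟨s', ⟨u, hu, hs'⟩, h⟩
    · rintro ⟨s', ⟨u, hu, hs'⟩, h⟩
      exact ⟨u, hu, s', hs', h⟩

theorem sat_entersWith (m : ℕ) (Φ Ψ : StateFormula AP) (s : S) :
    Sat N (entersWith m Φ Ψ) s ↔ (∃ s', N.ReachesIn m s s' ∧ Sat N Φ s') ∧
      ∀ s', N.ReachesIn m s s' → Sat N Φ s' → Sat N Ψ s' := by
  simp only [entersWith, StateFormula.Sat, sat_iterate_possiblyNext]
  simp

/-- If only one of the states that satisfy `Φ` can follow `s`, then `P_{≥ p}[X Φ]` bounds the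
probability of the transition to that state. -/
theorem sat_prob_ge_next (Φ : StateFormula AP) (p : unitInterval) (s s' : S)
    (hs' : Sat N Φ s') (huniq : ∀ u, Sat N Φ u → u ≠ s' → N.P s u = 0) :
    Sat N (.prob .ge p (.next Φ)) s ↔ (p : ℝ) ≤ N.P s s' := by
  classical
  have h := N.pathProb_next s {s' | Sat N Φ s'}
  simp only [Set.mem_ofPred_eq] at h
  rw [Finset.sum_eq_single s'] at h
  · simp only [StateFormula.Sat, PathFormula.Sat, Cmp.holds, h, hs', if_true]
    exact ENNReal.ofReal_le_ofReal_iff (N.P_nonneg _ _)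
  · intro u _ hu
    split_ifs with h'
    · simp [huniq u h' hu]
    · rfl
  · simp

/-- If finitely many states have distinct label sets, each of them is characterised by a formula. -/
theorem exists_characteristic {S₀ : Type*} [Finite S₀] {L : S₀ → Set AP}
    (hL : Function.Injective L) (s : S₀) :
    ∃ Φ : StateFormula AP, ∀ {T : Type*} [Fintype T] (N : DTMC T AP RN) (t : T) (s' : S₀),
      N.L t = L s' → (Sat N Φ t ↔ s' = s) := by
  classical
  have := Fintype.ofFinite S₀
  -- Induction on the set of states to be told apart from `s`. Only labels enter, so the same
  -- formula serves for the perfect-perception and the DNN-perception chains.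
  suffices h : ∀ F : Finset S₀, ∃ Φ : StateFormula AP,
      ∀ {T : Type _} [Fintype T] (N : DTMC T AP RN) (t : T) (s' : S₀),
      N.L t = L s' → (s' = s → Sat N Φ t) ∧ (s' ∈ F → Sat N Φ t → s' = s) by
    obtain ⟨Φ, hΦ⟩ := h Finset.univ
    exact ⟨Φ, fun N t s' h => ⟨(hΦ N t s' h).2 (Finset.mem_univ _), (hΦ N t s' h).1⟩⟩
  intro F
  induction F using Finset.induction_on with
  | empty => exact ⟨.tt, fun N t s' _ => ⟨fun _ => trivial, by simp⟩⟩
  | insert a F _ ih =>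
    obtain ⟨Φ, hΦ⟩ := ih
    by_cases ha : a = s
    · refine ⟨Φ, fun N t s' h => ⟨(hΦ N t s' h).1, fun hs' hsat => ?_⟩⟩
      rcases Finset.mem_insert.1 hs' with rfl | hs'
      · exact ha
      · exact (hΦ N t s' h).2 hs' hsat
    -- An atom on which the labels of `a` and `s` differ; it is added with the sign that it has at
    -- `s`.
    · obtain ⟨q, hq⟩ : ∃ q, ¬ (q ∈ L a ↔ q ∈ L s) := by
        by_contra! hcon
        exact ha (hL (Set.ext hcon))
      by_cases hqs : q ∈ L s
      · refine ⟨.and Φ (.atom q), fun N t s' h => ?_⟩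
        simp only [StateFormula.Sat, h]
        refine ⟨fun e => ⟨(hΦ N t s' h).1 e, e ▸ hqs⟩, fun hs' hsat => ?_⟩
        rcases Finset.mem_insert.1 hs' with rfl | hs'
        · exact absurd (iff_of_true hsat.2 hqs) hq
        · exact (hΦ N t s' h).2 hs' hsat.1
      · refine ⟨.and Φ (.not (.atom q)), fun N t s' h => ?_⟩
        simp only [StateFormula.Sat, h]
        refine ⟨fun e => ⟨(hΦ N t s' h).1 e, e ▸ hqs⟩, fun hs' hsat => ?_⟩
        rcases Finset.mem_insert.1 hs' with rfl | hs'
        · exact absurd (iff_of_false hsat.2 hqs) hq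
        · exact (hΦ N t s' h).2 hs' hsat.1

end StateFormula

/-! ### Distributions on configurations -/

open Classical in
/-- The distribution that gives `a` the probability `q` and treats all other elements alike. -/
def spread {C : Type*} [Fintype C] (a : C) (q : ℝ) (b : C) : ℝ :=
  if b = a then q else (1 - q) / (Fintype.card C - 1)

section Spread

variable {C : Type*} [Fintype C] (a : C) {q : ℝ}

theorem spread_self (q : ℝ) : spread a q a = q := if_pos rfl

variable [Nontrivial C]

theorem card_sub_one_pos : (0 : ℝ) < Fintype.card C - 1 := by
  have : (1 : ℝ) < Fintype.card C := by exact_mod_cast Fintype.one_lt_card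
  linarith

theorem spread_nonneg (h0 : 0 ≤ q) (h1 : q ≤ 1) (b : C) : 0 ≤ spread a q b := by
  unfold spread
  split_ifs
  · exact h0
  · exact div_nonneg (sub_nonneg.2 h1) card_sub_one_pos.le

theorem spread_pos (h0 : 0 < q) (h1 : q < 1) (b : C) : 0 < spread a q b := by
  unfold spread
  split_ifs
  · exact h0
  · exact div_pos (sub_pos.2 h1) card_sub_one_pos

theorem sum_spread (q : ℝ) : ∑ b, spread a q b = 1 := by
  classical
  rw [← Finset.add_sum_erase _ _ (Finset.mem_univ a), spread_self]
  have hrest : ∀ b ∈ Finset.univ.erase a, spread a q b = (1 - q) / (Fintype.card C - 1) :=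
    fun b hb => if_neg (Finset.ne_of_mem_erase hb)
  rw [Finset.sum_congr rfl hrest, Finset.sum_const, Finset.card_erase_of_mem (Finset.mem_univ _), nsmul_eq_mul,
    Finset.card_univ, Nat.cast_sub Fintype.card_pos, Nat.cast_one,
    mul_div_cancel₀ _ card_sub_one_pos.ne']
  ring

end Spread

namespace PerfectModel

variable {Z C : Type*} {K : ℕ} {AP RN : Type*} (M : PerfectModel Z C K AP RN) [Fintype C]

-- Controllers with prescribed probabilities

section Controllers

variable [Nontrivial C]

open Classical in
/-- The controller that chooses `c₁` with probability `q₁` when the class is `k₁`, and `c₂` with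
probability `q₂` when it is not. -/
def spreadController (k₁ : Fin K) (c₁ c₂ : C) {q₁ q₂ : ℝ} (h₁ : q₁ ∈ Set.Icc (0 : ℝ) 1)
    (h₂ : q₂ ∈ Set.Icc (0 : ℝ) 1) : M.Controller where
  x _ k _ _ c' := if k = k₁ then spread c₁ q₁ c' else spread c₂ q₂ c'
  nonneg _ k _ _ c' := by
    split_ifs
    · exact spread_nonneg _ h₁.1 h₁.2 _
    · exact spread_nonneg _ h₂.1 h₂.2 _
  sum_eq_one _ k _ _ := by
    split_ifs <;> exact sum_spread _ _

theorem spreadController_fst {k₁ : Fin K} {c₁ c₂ : C} {q₁ q₂ : ℝ} (h₁ : q₁ ∈ Set.Icc (0 : ℝ) 1)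
    (h₂ : q₂ ∈ Set.Icc (0 : ℝ) 1) (z : Z) (c : C) (h) :
    (M.spreadController k₁ c₁ c₂ h₁ h₂).x z k₁ c h c₁ = q₁ := by
  simp [spreadController, spread_self]

theorem spreadController_snd {k₁ k : Fin K} (hk : k ≠ k₁) {c₁ c₂ : C} {q₁ q₂ : ℝ}
    (h₁ : q₁ ∈ Set.Icc (0 : ℝ) 1) (h₂ : q₂ ∈ Set.Icc (0 : ℝ) 1) (z : Z) (c : C) (h) :
    (M.spreadController k₁ c₁ c₂ h₁ h₂).x z k c h c₂ = q₂ := by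
  simp [spreadController, spread_self, hk]

theorem spreadController_pos {k₁ : Fin K} {c₁ c₂ : C} {q₁ q₂ : ℝ} (h₁ : q₁ ∈ Set.Icc (0 : ℝ) 1)
    (h₂ : q₂ ∈ Set.Icc (0 : ℝ) 1) (h₁' : q₁ ∈ Set.Ioo (0 : ℝ) 1) (h₂' : q₂ ∈ Set.Ioo (0 : ℝ) 1)
    (z : Z) (k : Fin K) (c : C) (h) (c' : C) :
    0 < (M.spreadController k₁ c₁ c₂ h₁ h₂).x z k c h c' := by
  simp only [spreadController]
  split_ifs
  · exact spread_pos _ h₁'.1 h₁'.2 _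
  · exact spread_pos _ h₂'.1 h₂'.2 _

end Controllers

/-! ### Entering control states -/

/-- A controller with positive parameters enters every state that can be entered, after a number
of steps that does not depend on the controller. -/
theorem CanEnter.exists_reachesIn {M : PerfectModel Z C K AP RN} {s : M.S} (h : M.CanEnter s) :
    ∃ m, ∀ x : M.Controller, (∀ z k c hz c', 0 < x.x z k c hz c') →
      (M.inst x).ReachesIn (m + 1) M.s₀ s := by
  have hstep : ∀ {s s' : M.S}, M.CanStep s s' → ∀ x : M.Controller,
      (∀ z k c hz c', 0 < x.x z k c hz c') → 0 < (M.inst x).P s s' := by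
    intro s s' h x hx
    change 0 < M.trans x s s'
    unfold trans
    rcases h with ⟨ht, h⟩ | ⟨ht, h⟩
    · rw [dif_pos ht, if_pos h]
      exact hx _ _ _ _ _
    · rwa [dif_neg ht]
  induction h with
  | single h => exact ⟨0, fun x hx => ⟨_, rfl, hstep h x hx⟩⟩
  | tail _ h ih =>
    obtain ⟨m, hm⟩ := ih
    exact ⟨m + 1, fun x hx => ⟨_, hm x hx, hstep h x hx⟩⟩

variable {d n : ℕ} (D : Perception d K n)

/-- A control state is entered together with each perception outcome that its class can have. -/
theorem dnnInst_reachesIn_outcome (y : M.DNNController n) {m : ℕ} {a : M.DNNState n} {s : M.S}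
    (hs : s.1.t = .control) {o o' : Fin K × (Fin n → Bool)} (ho : 0 < D.p s.1.k o.1 o.2)
    (h : (M.dnnInst D y).ReachesIn (m + 1) a (s, o')) :
    (M.dnnInst D y).ReachesIn (m + 1) a (s, o) := by
  -- At least one step is needed, since the initial state carries a fixed outcome. The last step
  -- into a control state starts in a monitor state: control steps lead to `system` states and
  -- system steps never lead to `control`. A monitor step draws the outcome afresh, with a factor
  -- that depends only on the new class.
  obtain ⟨u, hu, hpos⟩ := h
  refine ⟨u, hu, ?_⟩
  change 0 < M.dnnTrans D y u (s, o') at hpos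
  change 0 < M.dnnTrans D y u (s, o)
  unfold dnnTrans at hpos ⊢
  by_cases hc : u.1.1.t = .control
  · simp [hc, hs] at hpos
  · by_cases hm : u.1.1.t = .monitor
    · rw [dif_neg hc, if_pos hm] at hpos ⊢
      exact mul_pos (pos_of_mul_pos_left hpos (D.p_nonneg _ _ _)) ho
    · rw [dif_neg hc, if_neg hm] at hpos
      split_ifs at hpos
      · have hsys : u.1.1.t = .system := by
          cases ht : u.1.1.t <;> simp_all
        exact absurd hs (M.system_step _ _ hsys hpos).2.2
      · exact absurd hpos (lt_irrefl _)

/-! ### The separating combinations -/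

section Separation

variable {M}

theorem inst_P_control (x : M.Controller) {z : Z} {k : Fin K} {c : C}
    (h : (⟨z, k, .control, c⟩ : Tuple Z C K) ∈ M.S) (c' : C) :
    (M.inst x).P ⟨_, h⟩ ⟨_, M.control_mem _ _ _ h c'⟩ = x.x z k c h c' := by
  change M.trans x _ _ = _
  simp [trans]

theorem dnnInst_P_control (y : M.DNNController n) {z : Z} {k : Fin K} {c : C}
    (h : (⟨z, k, .control, c⟩ : Tuple Z C K) ∈ M.S) (o : Fin K × (Fin n → Bool)) (c' : C) :
    (M.dnnInst D y).P (⟨_, h⟩, o) (⟨_, M.control_mem _ _ _ h c'⟩, o) =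
      y.x z o.1 o.2 c ⟨k, h⟩ c' := by
  change M.dnnTrans D y _ _ = _
  simp [dnnTrans]

theorem dnnInst_P_control_of_ne (y : M.DNNController n) {s s' : M.S} (hs : s.1.t = .control)
    {o o' : Fin K × (Fin n → Bool)} (ho : o' ≠ o) : (M.dnnInst D y).P (s, o) (s', o') = 0 := by
  change M.dnnTrans D y _ _ = _
  simp [dnnTrans, hs, ho]

/-- There is a family of formulae, indexed by `p`, which under perfect perception say that the
control state is entered after a certain number of steps and that `c'` is chosen there with
probability at least `p`, and which force the same choice for each outcome of the perception. -/
theorem exists_enters_and_chooses (hL : Function.Injective M.L) {z : Z} {k : Fin K} {c : C}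
    (h : (⟨z, k, .control, c⟩ : Tuple Z C K) ∈ M.S) (he : M.CanEnter ⟨_, h⟩) (c' : C) :
    ∃ Φ : unitInterval → StateFormula AP,
      (∀ x : M.Controller, (∀ z k c hz c', 0 < x.x z k c hz c') → ∀ p : unitInterval,
        ((Φ p).Sat (M.inst x) M.s₀ ↔ (p : ℝ) ≤ x.x z k c h c')) ∧
      ∀ (y : M.DNNController n) (p : unitInterval) (khat : Fin K) (v : Fin n → Bool),
        (Φ p).Sat (M.dnnInst D y) (M.dnnInst D y).s₀ → 0 < D.p k khat v →
          (p : ℝ) ≤ y.x z khat v c ⟨k, h⟩ c' := by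
  obtain ⟨m, hm⟩ := he.exists_reachesIn
  obtain ⟨Φs, hΦs⟩ := StateFormula.exists_characteristic (RN := RN) hL ⟨_, h⟩
  obtain ⟨Φt, hΦt⟩ := StateFormula.exists_characteristic (RN := RN) hL
    ⟨_, M.control_mem _ _ _ h c'⟩
  -- The step number comes from the perfect-perception model. No reachability claim is needed for
  -- the DNN model, because a chain satisfying the formula enters the state by the first conjunct of
  -- `entersWith`.
  refine ⟨fun p => .entersWith (m + 1) Φs (.prob .ge p (.next Φt)), ?_, ?_⟩
  · intro x hx p
    have key := StateFormula.sat_prob_ge_next (M.inst x) Φt p ⟨_, h⟩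
      ⟨_, M.control_mem _ _ _ h c'⟩ ((hΦt (M.inst x) _ _ rfl).2 rfl)
      (fun u hu hne => absurd ((hΦt (M.inst x) u u rfl).1 hu) hne)
    rw [inst_P_control] at key
    rw [StateFormula.sat_entersWith, ← key]
    constructor
    · rintro ⟨-, hall⟩
      exact hall _ (hm x hx) ((hΦs (M.inst x) _ _ rfl).2 rfl)
    · intro hp
      refine ⟨⟨_, hm x hx, (hΦs (M.inst x) _ _ rfl).2 rfl⟩, fun s' _ hs' => ?_⟩
      rw [(hΦs (M.inst x) s' s' rfl).1 hs']
      exact hp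
  · intro y p khat v hsat hp
    rw [StateFormula.sat_entersWith] at hsat
    obtain ⟨⟨⟨s', o'⟩, hreach, hs'⟩, hall⟩ := hsat
    obtain rfl := (hΦs (M.dnnInst D y) (s', o') s' rfl).1 hs'
    -- The outcome `o'` of the entry found is arbitrary; it can be exchanged for any outcome of
    -- positive probability.
    have hch := hall (⟨_, h⟩, (khat, v)) (M.dnnInst_reachesIn_outcome D y rfl hp hreach)
      ((hΦs (M.dnnInst D y) _ _ rfl).2 rfl)
    rw [StateFormula.sat_prob_ge_next (M.dnnInst D y) Φt p _
      (⟨_, M.control_mem _ _ _ h c'⟩, (khat, v)) ((hΦt (M.dnnInst D y) _ _ rfl).2 rfl)] at hch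
    · rwa [dnnInst_P_control] at hch
    -- Copies of the target with another outcome satisfy `Φt` as well, but a control step keeps the
    -- outcome.
    · rintro ⟨u, o⟩ hu hne
      obtain rfl := (hΦt (M.dnnInst D y) (u, o) u rfl).1 hu
      refine dnnInst_P_control_of_ne D y rfl fun ho => hne ?_
      rw [ho]

variable [Nontrivial C]

/-- Infinitely many sets of controllers are the solution sets of separating combinations. -/
theorem infinite_image_separates (hL : Function.Injective M.L) {z : Z} {c : C}
    {k₁ k₂ khat : Fin K} {v : Fin n → Bool} (hk : k₁ ≠ k₂)
    (h₁ : (⟨z, k₁, .control, c⟩ : Tuple Z C K) ∈ M.S)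
    (h₂ : (⟨z, k₂, .control, c⟩ : Tuple Z C K) ∈ M.S)
    (he₁ : M.CanEnter ⟨_, h₁⟩) (he₂ : M.CanEnter ⟨_, h₂⟩)
    (hp₁ : 0 < D.p k₁ khat v) (hp₂ : 0 < D.p k₂ khat v) :
    ((fun Q : Combination AP RN => {x : M.Controller | Q.Sat (M.inst x)}) ''
      {Q | M.Separates D Q}).Infinite := by
  obtain ⟨c₁, c₂, hc⟩ := exists_pair_ne C
  obtain ⟨Φ₁, hx₁, hy₁⟩ := exists_enters_and_chooses D hL h₁ he₁ c₁
  obtain ⟨Φ₂, hx₂, hy₂⟩ := exists_enters_and_chooses D hL h₂ he₂ c₂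
  -- `q > 1/2` makes the two demands incompatible; `q < 1` keeps all parameters of the witness
  -- controller positive, so that it enters both states.
  have hI : ∀ q : Set.Ioo (1 / 2 : ℝ) 1, (q : ℝ) ∈ Set.Ioo (0 : ℝ) 1 :=
    fun q => ⟨by linarith [q.2.1], q.2.2⟩
  let p : Set.Ioo (1 / 2 : ℝ) 1 → unitInterval := fun q => ⟨q, Set.Ioo_subset_Icc_self (hI q)⟩
  let Q : Set.Ioo (1 / 2 : ℝ) 1 → Combination AP RN := fun q =>
    -- The objective only fills the required slot; the constraints alone separate.
    ⟨[.state (Φ₁ (p q)), .state (Φ₂ (p q))], [⟨.maximise, .prob (.next .tt)⟩], by simp⟩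
  let x : Set.Ioo (1 / 2 : ℝ) 1 → M.Controller := fun q =>
    M.spreadController k₁ c₁ c₂ (p q).2 (p q).2
  have hx : ∀ q q', (Q q').Sat (M.inst (x q)) ↔ (q' : ℝ) ≤ q := by
    intro q q'
    have hpos := M.spreadController_pos (k₁ := k₁) (c₁ := c₁) (c₂ := c₂) (p q).2 (p q).2
      (hI q) (hI q)
    have e₁ := hx₁ (x q) hpos (p q')
    have e₂ := hx₂ (x q) hpos (p q')
    rw [show (x q).x z k₁ c h₁ c₁ = q from M.spreadController_fst _ _ _ _ _] at e₁
    rw [show (x q).x z k₂ c h₂ c₂ = q from M.spreadController_snd hk.symm _ _ _ _ _] at e₂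
    simp only [Combination.Sat, Q, List.forall_mem_cons, Constraint.Sat]
    exact ⟨fun h => e₁.1 h.1, fun h => ⟨e₁.2 h, e₂.2 h, by simp⟩⟩
  have : Infinite (Set.Ioo (1 / 2 : ℝ) 1) := (Set.Ioo_infinite (by norm_num)).to_subtype
  refine Set.infinite_of_injective_forall_mem
    (f := fun q => {x : M.Controller | (Q q).Sat (M.inst x)}) ?_ ?_
  -- The controller `x q` meets `Q q'` exactly if `q' ≤ q`, so the solution set determines `q`.
  · intro q q' hqq'
    have h := Set.ext_iff.1 hqq'
    exact Subtype.ext (le_antisymm ((hx q' q).1 ((h (x q')).2 ((hx q' q').2 le_rfl)))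
      ((hx q q').1 ((h (x q)).1 ((hx q q).2 le_rfl))))
  · refine fun q => ⟨Q q, ⟨x q, (hx q q).2 le_rfl, ?_⟩, rfl⟩
    rintro ⟨y, hy, -⟩
    have b₁ := hy₁ y (p q) khat v (hy (.state (Φ₁ (p q))) (by simp [Q])) hp₁
    have b₂ := hy₂ y (p q) khat v (hy (.state (Φ₂ (p q))) (by simp [Q])) hp₂
    -- The existence proofs built from `h₁` and `h₂` are equal by proof irrelevance, so `b₁` and
    -- `b₂` bound entries of the same row.
    have hsum : y.x z khat v c ⟨k₁, h₁⟩ c₁ + y.x z khat v c ⟨k₁, h₁⟩ c₂ ≤ 1 := by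
      rw [← y.sum_eq_one z khat v c ⟨k₁, h₁⟩]
      exact Finset.add_le_sum (fun i _ => y.nonneg _ _ _ _ _ i) (Finset.mem_univ _)
        (Finset.mem_univ _) hc
    have hq : (1 / 2 : ℝ) < p q := q.2.1
    linarith

end Separation

/-! ### The equivalence equation -/

variable {M} {D}

theorem _root_.DeepDECS.Perception.p_add_sum_erase [DecidableEq (Fin K × (Fin n → Bool))]
    (D : Perception d K n) (k khat : Fin K) (v : Fin n → Bool) :
    D.p k khat v + ∑ o ∈ Finset.univ.erase (khat, v), D.p k o.1 o.2 = 1 := by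
  rw [Finset.add_sum_erase _ (fun o : Fin K × (Fin n → Bool) => D.p k o.1 o.2)
    (Finset.mem_univ (khat, v)), Fintype.sum_prod_type, D.p_sum]

theorem DNNController.le_one (y : M.DNNController n) (z : Z) (khat : Fin K) (v : Fin n → Bool)
    (c : C) (h) (c' : C) : y.x z khat v c h c' ≤ 1 := by
  rw [← y.sum_eq_one z khat v c h]
  exact Finset.single_le_sum (fun i _ => y.nonneg _ _ _ _ _ i) (Finset.mem_univ _)

/-- A solution of the equivalence equation chooses `c'` with probability at least `α`. -/
theorem EquivalenceEq.alpha_le {x : M.Controller} {y : M.DNNController n}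
    (hxy : M.EquivalenceEq D x y) {z : Z} {k : Fin K} {c : C}
    {h : (⟨z, k, .control, c⟩ : Tuple Z C K) ∈ M.S} {khat : Fin K} {v : Fin n → Bool} {c' : C}
    {α : ℝ} (hα : M.HasAlpha D x z k c h khat v c' α) (hp : 0 < D.p k khat v) :
    α ≤ y.x z khat v c ⟨k, h⟩ c' := by
  classical
  unfold HasAlpha at hα
  rw [hxy z k c h c', ← Fintype.sum_prod_type'
      (f := fun khat v => D.p k khat v * y.x z khat v c ⟨k, h⟩ c'),
    ← Finset.add_sum_erase _ _ (Finset.mem_univ (khat, v))] at hα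
  -- With the other parameters at most `1`, the common tail cancels and leaves `α * p ≤ p * y.x ⋯`.
  have hle : ∑ o ∈ Finset.univ.erase (khat, v), D.p k o.1 o.2 * y.x z o.1 o.2 c ⟨k, h⟩ c' ≤
      ∑ o ∈ Finset.univ.erase (khat, v), D.p k o.1 o.2 :=
    Finset.sum_le_sum fun o _ => mul_le_of_le_one_right (D.p_nonneg _ _ _) (y.le_one _ _ _ _ _ _)
  refine le_of_mul_le_mul_right ?_ hp
  linarith

/-- Both classes bound entries of one row from below, by `α₁` at `c₁` and by `α₂` at `c₂`, and the
row sums to `1`. -/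
theorem not_exists_equivalenceEq {z : Z} {c : C} {k₁ k₂ khat : Fin K} {v : Fin n → Bool}
    {h₁ : (⟨z, k₁, .control, c⟩ : Tuple Z C K) ∈ M.S}
    {h₂ : (⟨z, k₂, .control, c⟩ : Tuple Z C K) ∈ M.S}
    (hp₁ : 0 < D.p k₁ khat v) (hp₂ : 0 < D.p k₂ khat v) {x : M.Controller} {c₁ c₂ : C}
    {α₁ α₂ : ℝ} (hc : c₁ ≠ c₂) (hα : 1 < α₁ + α₂)
    (hα₁ : M.HasAlpha D x z k₁ c h₁ khat v c₁ α₁) (hα₂ : M.HasAlpha D x z k₂ c h₂ khat v c₂ α₂) :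
    ¬ ∃ y : M.DNNController n, M.EquivalenceEq D x y := by
  rintro ⟨y, hy⟩
  have b₁ := hy.alpha_le hα₁ hp₁
  have b₂ := hy.alpha_le hα₂ hp₂
  have hsum : y.x z khat v c ⟨k₁, h₁⟩ c₁ + y.x z khat v c ⟨k₁, h₁⟩ c₂ ≤ 1 := by
    rw [← y.sum_eq_one z khat v c ⟨k₁, h₁⟩]
    exact Finset.add_le_sum (fun i _ => y.nonneg _ _ _ _ _ i) (Finset.mem_univ _)
      (Finset.mem_univ _) hc
  linarith

theorem infinite_hasAlpha [Nontrivial C] (M : PerfectModel Z C K AP RN) (D : Perception d K n)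
    {z : Z} {c : C} {k₁ k₂ khat : Fin K} {v : Fin n → Bool} (hk : k₁ ≠ k₂)
    (h₁ : (⟨z, k₁, .control, c⟩ : Tuple Z C K) ∈ M.S)
    (h₂ : (⟨z, k₂, .control, c⟩ : Tuple Z C K) ∈ M.S) (hp₂ : 0 < D.p k₂ khat v) :
    {x : M.Controller | ∃ c₁ c₂ : C, c₁ ≠ c₂ ∧ ∃ α₁ ∈ Set.Icc (0 : ℝ) 1,
      ∃ α₂ ∈ Set.Icc (0 : ℝ) 1, 1 < α₁ + α₂ ∧ M.HasAlpha D x z k₁ c h₁ khat v c₁ α₁ ∧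
        M.HasAlpha D x z k₂ c h₂ khat v c₂ α₂}.Infinite := by
  classical
  obtain ⟨c₁, c₂, hc⟩ := exists_pair_ne C
  have s₁ := D.p_add_sum_erase k₁ khat v
  have s₂ := D.p_add_sum_erase k₂ khat v
  have hrest : 0 ≤ ∑ o ∈ Finset.univ.erase (khat, v), D.p k₂ o.1 o.2 :=
    Finset.sum_nonneg fun _ _ => D.p_nonneg _ _ _
  have hq : ∀ α : Set.Ioo (0 : ℝ) 1, α * D.p k₂ khat v +
      ∑ o ∈ Finset.univ.erase (khat, v), D.p k₂ o.1 o.2 ∈ Set.Icc (0 : ℝ) 1 := fun α =>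
    ⟨add_nonneg (mul_nonneg α.2.1.le hp₂.le) hrest,
      by linarith [mul_le_of_le_one_left hp₂.le α.2.2.le]⟩
  have hone : (1 : ℝ) ∈ Set.Icc (0 : ℝ) 1 := ⟨zero_le_one, le_rfl⟩
  have : Infinite (Set.Ioo (0 : ℝ) 1) := (Set.Ioo_infinite one_pos).to_subtype
  -- The choice is `α₁ = 1`, which by total mass `1` means choosing `c₁` surely for `k₁`, and `α₂ =
  -- α` free in `(0, 1)`. Different `α` give different controllers because `D.p k₂ khat v` is
  -- nonzero.
  refine Set.infinite_of_injective_forall_mem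
    (f := fun α : Set.Ioo (0 : ℝ) 1 => M.spreadController k₁ c₁ c₂ hone (hq α)) ?_ ?_
  · intro α β hαβ
    have h := congrArg (fun x : M.Controller => x.x z k₂ c h₂ c₂) hαβ
    simp only [M.spreadController_snd hk.symm] at h
    exact Subtype.ext (mul_right_cancel₀ hp₂.ne' (add_right_cancel h))
  · intro α
    refine ⟨c₁, c₂, hc, 1, hone, α, Set.Ioo_subset_Icc_self α.2, by linarith [α.2.1], ?_, ?_⟩
    · unfold HasAlpha
      rw [M.spreadController_fst, one_mul, ← s₁]
    · unfold HasAlpha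
      rw [M.spreadController_snd hk.symm]

end PerfectModel

end DeepDECS

end

theorem corollary2 {Z C : Type*} [Fintype C] [Nontrivial C] {d K n : ℕ} {AP RN : Type*}
    (M : DeepDECS.PerfectModel Z C K AP RN) (D : DeepDECS.Perception d K n)
    (hL : Function.Injective M.L)
    (z : Z) (c : C) (k₁ k₂ khat : Fin K) (v : Fin n → Bool) (hk : k₁ ≠ k₂)
    (h₁ : (⟨z, k₁, .control, c⟩ : DeepDECS.Tuple Z C K) ∈ M.S)
    (h₂ : (⟨z, k₂, .control, c⟩ : DeepDECS.Tuple Z C K) ∈ M.S)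
    (he₁ : M.CanEnter ⟨_, h₁⟩) (he₂ : M.CanEnter ⟨_, h₂⟩)
    (hp₁ : 0 < D.p k₁ khat v) (hp₂ : 0 < D.p k₂ khat v) :
    {Q : DeepDECS.Combination AP RN | M.Separates D Q}.Infinite ∧
    ((fun Q : DeepDECS.Combination AP RN => {x : M.Controller | Q.Sat (M.inst x)}) ''
      {Q | M.Separates D Q}).Infinite ∧
    (∀ (x : M.Controller) (c₁ c₂ : C) (α₁ α₂ : ℝ), c₁ ≠ c₂ → 1 < α₁ + α₂ →
      M.HasAlpha D x z k₁ c h₁ khat v c₁ α₁ → M.HasAlpha D x z k₂ c h₂ khat v c₂ α₂ →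
      ¬ ∃ y : M.DNNController n, M.EquivalenceEq D x y) ∧
    {x : M.Controller | ∃ c₁ c₂ : C, c₁ ≠ c₂ ∧ ∃ α₁ ∈ Set.Icc (0 : ℝ) 1, ∃ α₂ ∈ Set.Icc (0 : ℝ) 1,
      1 < α₁ + α₂ ∧ M.HasAlpha D x z k₁ c h₁ khat v c₁ α₁ ∧
        M.HasAlpha D x z k₂ c h₂ khat v c₂ α₂}.Infinite := by
  have hinf := DeepDECS.PerfectModel.infinite_image_separates D hL hk h₁ h₂ he₁ he₂ hp₁ hp₂
  exact ⟨hinf.of_image _, hinf,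
    fun _ _ _ _ _ hc hα hα₁ hα₂ =>
      DeepDECS.PerfectModel.not_exists_equivalenceEq hp₁ hp₂ hc hα hα₁ hα₂,
    M.infinite_hasAlpha D hk h₁ h₂ hp₂⟩
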